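/- Let $a>0$ be real, let $k$ be a complex function that is analytic at every point of the interval $[0,a]\subset\mathbb{C}$, and let $n$ and $\mathfrak{b}$ be positive integers. Then the finite-part integral of $k(t)\,t^{-\mathfrak{b}}\ln^n t$ over $[0,a]$ exists, and for every admissible contour $C$ $$ \mathrm{f.p.}\!\int_0^a \frac{k(t)\ln^n t}{t^{\mathfrak{b}}}\,\mathrm{d}t = \frac{1}{2\pi i\,(n+1)}\int_C \frac{k(z)}{z^{\mathfrak{b}}}\,\ln^{n+1} z\,\mathrm{d}z +\sum_{j=0}^{n}\binom{n}{j}(2\pi i)^{n-j}\,\frac{B_{n-j+1}}{n-j+1}\int_C \frac{k(z)}{z^{\mathfrak{b}}}\,\ln^{j} z\,\mathrm{d}z , $$ where $B_m$ are the Bernoulli numbers (with $B_1=-\tfrac12$), and the following notions are used. *Finite part.* The finite part of $\int_0^a f(t)\,\mathrm{d}t$ is $\lim_{\epsilon\to0^+}C_\epsilon$, where $\int_\epsilon^a f(t)\,\mathrm{d}t=C_\epsilon+D_\epsilon$ for $0<\epsilon<a$, $C_\epsilon$ converges as $\epsilon\to0^+$, and $D_\epsilon$ is a finite complex linear combination of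 the divergent terms $\epsilon^{-\alpha}(\ln\epsilon)^p$ with real $\alpha>0$ and integer $p\ge0$, or $\alpha=0$ and integer $p\ge1$. (The limit does not depend on the decomposition.) *Logarithm.* On $C$, $\ln z=\ln|z|+i\arg z$ with $0\le\arg z<2\pi$, with branch cut $[0,\infty)$. *Contour.* An admissible contour $C$ is a piecewise $C^1$ path that starts at $a$ on the upper side of the branch cut $[0,\infty)$, goes around the origin without meeting $[0,\infty)$ between its end points, and ends at $a$ on the lower side of the cut. It neither encloses a singularity nor crosses a branch cut of $k$: $C$ and $[0,a]$ lie in a simply connected open set on which $k$ is analytic. -/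

import Mathlib

open Filter Topology

/-! ### Finite-part integrals -/

/-- The elementary divergent terms `ε ^ (-α) * (ln ε) ^ p`, indexed by pairs `(α, p)`. -/
noncomputable def divergentTerm (i : ℝ × ℕ) (ε : ℝ) : ℂ :=
  ((ε ^ (-i.1) * Real.log ε ^ i.2 : ℝ) : ℂ)

/-- The space of possible divergent parts: finite linear combinations of those
functions `ε ^ (-α) * (ln ε) ^ p` that are unbounded as `ε → 0+`, that is `α > 0`, or
`α = 0` and `p ≥ 1`. -/
noncomputable def divergentParts : Submodule ℂ (ℝ → ℂ) :=
  Submodule.span ℂ (divergentTerm '' {i : ℝ × ℕ | 0 < i.1 ∨ (i.1 = 0 ∧ 0 < i.2)})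

/-- `HasFinitePart f a L`: the (possibly divergent) integral of `f` over `[0, a]` has the finite
part `L`. That is, `∫_ε^a f = C_ε + D_ε` for `0 < ε < a`, where `D_ε` is a divergent part
and `C_ε → L` as `ε → 0+`. -/
def HasFinitePart (f : ℝ → ℂ) (a : ℝ) (L : ℂ) : Prop :=
  (∀ ε ∈ Set.Ioo 0 a, IntervalIntegrable f MeasureTheory.volume ε a) ∧
    ∃ D ∈ divergentParts,
      Tendsto (fun ε : ℝ => (∫ t in ε..a, f t) - D ε) (𝓝[>] 0) (𝓝 L)

open Classical in
/-- The finite-part integral of `f` over `[0, a]` (and `0` if there is no finite part). -/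
noncomputable def finitePart (f : ℝ → ℂ) (a : ℝ) : ℂ :=
  if h : ∃ L, HasFinitePart f a L then h.choose else 0

/-- In the variable `x = -ln ε`, a divergent term is, up to sign, `e ^ (α x) x ^ p`; a term that is
lexicographically smaller is negligible against a larger one. -/
theorem tendsto_exp_mul_pow_div {α β : ℝ} {p q : ℕ} (h : α < β ∨ (α = β ∧ p < q)) :
    Tendsto (fun x : ℝ => (Real.exp (α * x) * x ^ p) / (Real.exp (β * x) * x ^ q))
      atTop (𝓝 0) := by
  rcases h with h | ⟨rfl, h⟩
  · have h1 : Tendsto (fun x : ℝ => x ^ p / Real.exp ((β - α) * x)) atTop (𝓝 0) := by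
      have := (isLittleO_pow_exp_pos_mul_atTop (k := p) (sub_pos.2 h)).tendsto_div_nhds_zero
      simpa using this
    refine squeeze_zero' ?_ ?_ h1
    · filter_upwards [eventually_ge_atTop (1 : ℝ)] with x hx
      positivity
    · filter_upwards [eventually_ge_atTop (1 : ℝ)] with x hx
      have hq : (1 : ℝ) ≤ x ^ q := one_le_pow₀ hx
      have he : Real.exp (β * x) = Real.exp (α * x) * Real.exp ((β - α) * x) := by
        rw [← Real.exp_add]; ring_nf
      rw [he, mul_assoc, mul_div_mul_left _ _ (Real.exp_pos _).ne']
      apply div_le_div_of_nonneg_left (by positivity) (Real.exp_pos _)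
      exact le_mul_of_one_le_right (Real.exp_pos _).le hq
  · have h1 : Tendsto (fun x : ℝ => x ^ p / x ^ q) atTop (𝓝 0) :=
      tendsto_pow_div_pow_atTop_zero h
    refine h1.congr fun x => ?_
    rw [mul_div_mul_left _ _ (Real.exp_pos _).ne']

/-- Linear independence of the scale, in the variable `x = -ln ε`. -/
theorem coeff_eq_zero_of_tendsto (S : Finset (ℝ ×ₗ ℕ)) (c : ℝ ×ₗ ℕ → ℂ)
    (hS : ∀ i ∈ S, toLex ((0 : ℝ), (0 : ℕ)) ≤ i)
    (h : Tendsto (fun x : ℝ => ∑ i ∈ S, c i *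
      ((Real.exp ((ofLex i).1 * x) * x ^ (ofLex i).2 : ℝ) : ℂ)) atTop (𝓝 0)) :
    ∀ i ∈ S, c i = 0 := by
  induction S using Finset.induction_on_max with
  | empty => simp
  | insert m s hm ih =>
    have hms : m ∉ s := fun hmem => lt_irrefl _ (hm m hmem)
    have key : c m = 0 := by
      set φ : ℝ ×ₗ ℕ → ℝ → ℝ := fun i x => Real.exp ((ofLex i).1 * x) * x ^ (ofLex i).2 with hφ
      have hφ1 : ∀ᶠ x in atTop, (1 : ℝ) ≤ φ m x := by
        have hm0 := hS m (Finset.mem_insert_self _ _)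
        have h1 : 0 ≤ (ofLex m).1 := by
          rcases (Prod.Lex.le_iff).1 hm0 with h | h
          · exact le_of_lt h
          · exact le_of_eq h.1
        filter_upwards [eventually_ge_atTop (1 : ℝ)] with x hx
        have e1 : 1 ≤ Real.exp ((ofLex m).1 * x) := Real.one_le_exp (by positivity)
        have e2 : 1 ≤ x ^ (ofLex m).2 := one_le_pow₀ hx
        exact one_le_mul_of_one_le_of_one_le e1 e2
      have hA : Tendsto (fun x : ℝ => (∑ i ∈ insert m s, c i * ((φ i x : ℝ) : ℂ)) /
          ((φ m x : ℝ) : ℂ)) atTop (𝓝 0) := by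
        refine squeeze_zero_norm' ?_ (tendsto_zero_iff_norm_tendsto_zero.1 h)
        filter_upwards [hφ1] with x hx
        rw [norm_div, Complex.norm_real, Real.norm_of_nonneg (by linarith)]
        exact div_le_self (norm_nonneg _) hx
      have hB : Tendsto (fun x : ℝ => c m + ∑ i ∈ s, c i * ((φ i x / φ m x : ℝ) : ℂ)) atTop
          (𝓝 (c m + ∑ i ∈ s, c i * ((0 : ℝ) : ℂ))) := by
        refine tendsto_const_nhds.add (tendsto_finsetSum _ fun i hi => ?_)
        refine tendsto_const_nhds.mul ((Complex.continuous_ofReal.tendsto _).comp ?_)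
        apply tendsto_exp_mul_pow_div
        exact Prod.Lex.lt_iff.1 (hm i hi)
      have hC : Tendsto (fun x : ℝ => c m + ∑ i ∈ s, c i * ((φ i x / φ m x : ℝ) : ℂ)) atTop
          (𝓝 0) := by
        refine hA.congr' ?_
        filter_upwards [hφ1] with x hx
        have hne : ((φ m x : ℝ) : ℂ) ≠ 0 := by
          exact_mod_cast (by linarith : φ m x ≠ 0)
        rw [Finset.sum_insert hms, add_div, mul_div_cancel_right₀ _ hne, Finset.sum_div]
        congr 1
        refine Finset.sum_congr rfl fun i _ => ?_
        push_cast
        rw [mul_div_assoc]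
      simpa using tendsto_nhds_unique hB hC
    intro i hi
    rcases Finset.mem_insert.1 hi with rfl | hi
    · exact key
    · refine ih (fun j hj => hS j (Finset.mem_insert_of_mem hj)) ?_ i hi
      simpa [Finset.sum_insert hms, key] using h

/-- A divergent part that converges as `ε → 0+` converges to `0`. -/
theorem eq_zero_of_mem_divergentParts {D : ℝ → ℂ} (hD : D ∈ divergentParts) {c : ℂ}
    (h : Tendsto D (𝓝[>] 0) (𝓝 c)) : c = 0 := by
  classical
  obtain ⟨l, hl, rfl⟩ := (Finsupp.mem_span_image_iff_linearCombination ℂ).1 hD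
  rw [Finsupp.mem_supported] at hl
  have hx : Tendsto (fun x : ℝ => Real.exp (-x)) atTop (𝓝[>] 0) := by
    refine tendsto_nhdsWithin_iff.2 ⟨Real.tendsto_exp_neg_atTop_nhds_zero, ?_⟩
    exact Eventually.of_forall fun x => Real.exp_pos _
  have h2 := (h.comp hx).sub (tendsto_const_nhds (x := c))
  rw [sub_self] at h2
  set z : ℝ ×ₗ ℕ := toLex ((0 : ℝ), (0 : ℕ)) with hz
  set T : Finset (ℝ ×ₗ ℕ) := l.support.map toLex.toEmbedding with hT
  have hpos : ∀ i ∈ T, z < i := by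
    intro i hi
    obtain ⟨j, hj, rfl⟩ := Finset.mem_map.1 hi
    rw [hz, Prod.Lex.lt_iff]
    rcases hl hj with h | h
    · exact Or.inl h
    · exact Or.inr ⟨h.1.symm, h.2⟩
  have hzT : z ∉ T := fun hmem => lt_irrefl _ (hpos z hmem)
  have := coeff_eq_zero_of_tendsto (insert z T)
    (fun i => if i = z then -c else l (ofLex i) * (-1) ^ (ofLex i).2) ?_ ?_ z
      (Finset.mem_insert_self _ _)
  · simpa using this
  · intro i hi
    rcases Finset.mem_insert.1 hi with rfl | hi
    · exact le_rfl
    · exact (hpos i hi).le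
  · refine h2.congr fun x => ?_
    rw [Finset.sum_insert hzT, hT, Finset.sum_map]
    have h0 : (ofLex z) = ((0 : ℝ), (0 : ℕ)) := rfl
    simp only [h0]
    have hsum : ∀ j ∈ l.support, (if (toLex.toEmbedding j) = z then -c else
        l (ofLex (toLex.toEmbedding j)) * (-1) ^ (ofLex (toLex.toEmbedding j)).2) *
        ((Real.exp ((ofLex (toLex.toEmbedding j)).1 * x) *
          x ^ (ofLex (toLex.toEmbedding j)).2 : ℝ) : ℂ) =
        l j * divergentTerm j (Real.exp (-x)) := by
      intro j hj
      have hne : toLex.toEmbedding j ≠ z := by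
        intro he
        exact hzT (he ▸ Finset.mem_map_of_mem _ hj)
      rw [if_neg hne]
      have e1 : Real.exp (-x) ^ (-j.1) = Real.exp (j.1 * x) := by
        rw [← Real.exp_mul]; ring_nf
      have e2 : ofLex (toLex.toEmbedding j) = j := rfl
      simp only [e2, divergentTerm, Real.log_exp, e1]
      rw [neg_pow x]
      push_cast
      ring
    rw [Finset.sum_congr rfl hsum]
    simp [Finsupp.linearCombination_apply, Finsupp.sum, Finset.sum_apply]
    ring

/-- The finite part of an integral is unique. -/
theorem HasFinitePart.unique {f : ℝ → ℂ} {a : ℝ} {L L' : ℂ} (h : HasFinitePart f a L)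
    (h' : HasFinitePart f a L') : L = L' := by
  obtain ⟨-, D, hD, hL⟩ := h
  obtain ⟨-, D', hD', hL'⟩ := h'
  have h1 : Tendsto (D' - D) (𝓝[>] 0) (𝓝 (L - L')) := by
    refine (hL.sub hL').congr fun ε => ?_
    simp only [Pi.sub_apply]
    ring
  exact sub_eq_zero.1 (eq_zero_of_mem_divergentParts (Submodule.sub_mem _ hD' hD) h1)

theorem HasFinitePart.finitePart_eq {f : ℝ → ℂ} {a : ℝ} {L : ℂ} (h : HasFinitePart f a L) :
    finitePart f a = L := by
  have hex : ∃ L, HasFinitePart f a L := ⟨L, h⟩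
  rw [finitePart, dif_pos hex]
  exact hex.choose_spec.unique h

/-! ### The logarithm and the contour -/

/-- The branch `ln z = ln |z| + i arg z` of the logarithm with `0 ≤ arg z < 2π`. -/
noncomputable def cutLog (z : ℂ) : ℂ :=
  (Real.log ‖z‖ : ℂ) +
    ((if 0 ≤ z.arg then z.arg else z.arg + 2 * Real.pi : ℝ) : ℂ) * Complex.I

/-- The contour integral `∫_γ g(z) dz`. -/
noncomputable def contourIntegral {z w : ℂ} (γ : Path z w) (g : ℂ → ℂ) : ℂ :=
  curveIntegral (fun ζ => ContinuousLinearMap.toSpanSingleton ℂ (g ζ)) γ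

/-- A path is piecewise `C¹` if there are finitely many breakpoints such that it is `C¹`, up to the
end points, on each interval without a breakpoint in its interior. -/
def IsPiecewiseC1 {z w : ℂ} (γ : Path z w) : Prop :=
  ∃ s : Finset ℝ, ∀ u v : ℝ, 0 ≤ u → u < v → v ≤ 1 → (∀ x ∈ s, x ∉ Set.Ioo u v) →
    ContDiffOn ℝ 1 γ.extend (Set.Icc u v)

/-- `IsStraddlingContour k a γ`: the path `γ` is an admissible contour of integration for `k`. It
starts at `a` on the upper side of the branch cut `[0, ∞)` of `cutLog`, goes around the
origin without meeting the cut, and comes back to `a` on the lower side. It neither encloses a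
singularity nor crosses a branch cut of `k`: together with `[0, a]` it lies in a simply connected
open set on which `k` is analytic. -/
structure IsStraddlingContour (k : ℂ → ℂ) (a : ℝ) (γ : Path (a : ℂ) (a : ℂ)) : Prop where
  piecewiseC1 : IsPiecewiseC1 γ
  avoids_cut : ∀ t ∈ Set.Ioo (0 : ℝ) 1, ∀ x : ℝ, 0 ≤ x → γ.extend t ≠ (x : ℂ)
  starts_above : ∀ᶠ t in 𝓝[>] (0 : ℝ), 0 < (γ.extend t).im
  ends_below : ∀ᶠ t in 𝓝[<] (1 : ℝ), (γ.extend t).im < 0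
  encloses_no_singularity : ∃ U : Set ℂ, IsOpen U ∧ IsSimplyConnected U ∧
    (fun t : ℝ => (t : ℂ)) '' Set.Icc 0 a ⊆ U ∧ Set.range γ ⊆ U ∧ AnalyticOnNhd ℂ k U

/-- Admissible contours exist whenever `k` is analytic on `[0, a]`: a thin ellipse through `a`. -/
theorem exists_isStraddlingContour {k : ℂ → ℂ} {a : ℝ} (ha : 0 < a)
    (hk : AnalyticOnNhd ℂ k ((fun t : ℝ => (t : ℂ)) '' Set.Icc 0 a)) :
    ∃ γ : Path (a : ℂ) (a : ℂ), IsStraddlingContour k a γ := by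
  set K : Set ℂ := (fun t : ℝ => (t : ℂ)) '' Set.Icc 0 a with hK
  have hKc : IsCompact K := isCompact_Icc.image Complex.continuous_ofReal
  have hKconv : Convex ℝ K := (convex_Icc (0 : ℝ) a).linear_image Complex.ofRealCLM.toLinearMap
  obtain ⟨δ, hδ, hsub⟩ := hKc.exists_thickening_subset_open (isOpen_analyticAt ℂ k) hk
  have hUconv : Convex ℝ (Metric.thickening δ K) := hKconv.thickening δ
  set η : ℝ := δ / 4 with hη
  have hηpos : 0 < η := by positivity
  set F : ℝ → ℂ := fun t =>
    ((a - (a + η) * (1 - Real.cos (2 * Real.pi * t)) / 2 : ℝ) : ℂ) +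
      ((η * Real.sin (2 * Real.pi * t) : ℝ) : ℂ) * Complex.I with hF
  have hre : ∀ t, (F t).re = a - (a + η) * (1 - Real.cos (2 * Real.pi * t)) / 2 := by
    intro t
    simp only [hF, Complex.add_re, Complex.ofReal_re, Complex.re_ofReal_mul, Complex.I_re]
    ring
  have him : ∀ t, (F t).im = η * Real.sin (2 * Real.pi * t) := by
    intro t
    simp only [hF, Complex.add_im, Complex.ofReal_im, Complex.im_ofReal_mul, Complex.I_im]
    ring
  have hFs : ContDiff ℝ 1 F := by
    have h1 : ContDiff ℝ 1 fun t : ℝ =>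
        a - (a + η) * (1 - Real.cos (2 * Real.pi * t)) / 2 := by fun_prop
    have h2 : ContDiff ℝ 1 fun t : ℝ => η * Real.sin (2 * Real.pi * t) := by fun_prop
    exact (Complex.ofRealCLM.contDiff.comp h1).add
      ((Complex.ofRealCLM.contDiff.comp h2).mul contDiff_const)
  let γ : Path (a : ℂ) (a : ℂ) :=
    { toFun := fun t => F t
      continuous_toFun := hFs.continuous.comp continuous_subtype_val
      source' := by simp [hF]
      target' := by simp [hF] }
  have hext : ∀ t ∈ Set.Icc (0 : ℝ) 1, γ.extend t = F t := fun t ht => by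
    rw [Path.extend_apply _ ht]; rfl
  have hpi := Real.pi_pos
  have hup : ∀ t ∈ Set.Ioo (0 : ℝ) (1 / 2), 0 < (γ.extend t).im := by
    intro t ht
    rw [hext t ⟨ht.1.le, by linarith [ht.2]⟩, him]
    exact mul_pos hηpos (Real.sin_pos_of_pos_of_lt_pi (by have := ht.1; positivity)
      (by nlinarith [ht.2]))
  have hdown : ∀ t ∈ Set.Ioo (1 / 2 : ℝ) 1, (γ.extend t).im < 0 := by
    intro t ht
    rw [hext t ⟨by linarith [ht.1], ht.2.le⟩, him]
    refine mul_neg_of_pos_of_neg hηpos ?_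
    have h1 : Real.sin (2 * Real.pi * t) = Real.sin (2 * Real.pi * t - 2 * Real.pi) :=
      (Real.sin_sub_two_pi _).symm
    rw [h1]
    exact Real.sin_neg_of_neg_of_neg_pi_lt (by nlinarith [ht.2]) (by nlinarith [ht.1])
  refine ⟨γ, ⟨∅, fun u v hu huv hv _ => ?_⟩, ?_, ?_, ?_, Metric.thickening δ K,
    Metric.isOpen_thickening, ?_, Metric.self_subset_thickening hδ K, ?_, fun z hz => hsub hz⟩
  · exact hFs.contDiffOn.congr fun t ht => hext t ⟨hu.trans ht.1, ht.2.trans hv⟩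
  · intro t ht x hx he
    rcases lt_trichotomy t (1 / 2) with h | h | h
    · have := hup t ⟨ht.1, h⟩
      rw [he, Complex.ofReal_im] at this
      exact lt_irrefl _ this
    · have h1 : (γ.extend t).re = x := by rw [he, Complex.ofReal_re]
      rw [hext t ⟨ht.1.le, ht.2.le⟩, hre, h] at h1
      have h2 : 2 * Real.pi * (1 / 2) = Real.pi := by ring
      rw [h2, Real.cos_pi] at h1
      linarith
    · have := hdown t ⟨h, ht.2⟩
      rw [he, Complex.ofReal_im] at this
      exact lt_irrefl _ this
  · filter_upwards [Ioo_mem_nhdsGT (by norm_num : (0 : ℝ) < 1 / 2)] with t ht using hup t ht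
  · filter_upwards [Ioo_mem_nhdsLT (by norm_num : (1 / 2 : ℝ) < 1)] with t ht using hdown t ht
  · have hne : (Metric.thickening δ K).Nonempty :=
      ⟨0, Metric.self_subset_thickening hδ K ⟨0, ⟨le_rfl, ha.le⟩, by simp⟩⟩
    have := hUconv.contractibleSpace hne
    exact (inferInstance : SimplyConnectedSpace (Metric.thickening δ K))
  · rintro _ ⟨t, rfl⟩
    have hFt : γ t = F t := rfl
    rw [hFt, Metric.mem_thickening_iff]
    have hc1 := Real.neg_one_le_cos (2 * Real.pi * t)
    have hc2 := Real.cos_le_one (2 * Real.pi * t)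
    set q : ℝ := (1 - Real.cos (2 * Real.pi * t)) / 2 with hq
    have hq0 : 0 ≤ q := by rw [hq]; linarith
    have hq1 : q ≤ 1 := by rw [hq]; linarith
    refine ⟨((a - a * q : ℝ) : ℂ), ⟨a - a * q, ⟨by nlinarith, by nlinarith⟩, rfl⟩, ?_⟩
    rw [dist_eq_norm]
    refine (Complex.norm_le_abs_re_add_abs_im _).trans_lt ?_
    rw [Complex.sub_re, Complex.sub_im, hre, him, Complex.ofReal_re, Complex.ofReal_im]
    have e1 : a - (a + η) * (1 - Real.cos (2 * Real.pi * t)) / 2 - (a - a * q) = -(η * q) := by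
      rw [hq]; ring
    rw [e1, abs_neg, abs_of_nonneg (by positivity), sub_zero, abs_mul, abs_of_pos hηpos]
    have e2 := Real.abs_sin_le_one (2 * Real.pi * t)
    nlinarith

/-!
Write `w = 2πi`, and `ΔQ = Q(X + w) - Q(X)` for a polynomial `Q`. A contour around the origin carries
the logarithm from `ln a` to `ln a + w`, so an integral of `g(z) Q(log z)` along it should be the
integral of the jump `g(t) ΔQ(ln t)` across the cut. For divergent integrals this is true for finite
parts, up to a residue: for `g = k / z ^ b` and every polynomial `R`,
`f.p. ∫₀ᵃ g(t) ΔR'(ln t) dt = ∫_C g(z) R'(log z) dz - c (R(w) - R(0))`, with a constant `c`, the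
residue of `g` at `0` (`exists_hasJumpFormula_div_pow`).

No contour is deformed in the proof. If `(z g₁)' = g`, then integration by parts turns both sides of
the formula for `g` and `R` into the same boundary term minus the two sides for `g₁` and the polynomial
`R'` (`hasJumpFormula_zero_of_closed`). Hence induction on the degree gives the formula, with `c = 0`,
for powers `z ^ (-p)` with `p ≥ 2` and for functions that are analytic on the simply connected set `U`.
For the latter, `g₁` is a primitive of `g` divided by `z`, and primitives exist on `U` because their
germs form a covering space of `U`, which has a section
(`DifferentiableOn.isExactOn_of_isSimplyConnected`). The remaining case `1 / z` is integrated
explicitly and has `c = 1`. Splitting off the Taylor coefficients of `k` yields the general case.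

It remains to choose `R` with `ΔR' = X ^ n` and `R(w) = R(0)`. The Bernoulli polynomials give
`R' = w ^ n / (n + 1) * B_{n+1}(X / w)`, whose coefficients are those of the theorem, and
`R(w) = R(0)` is `B_{n+2}(1) = B_{n+2}(0)`.
-/

/-! ### Primitives on simply connected sets -/

/-- Two primitives of the same function differ by a locally constant function. -/
theorem eventually_sub_eq_of_hasDerivAt {f F G : ℂ → ℂ} {V : Set ℂ} (hV : IsOpen V)
    (hF : ∀ z ∈ V, HasDerivAt F (f z) z) (hG : ∀ z ∈ V, HasDerivAt G (f z) z) {z : ℂ}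
    (hz : z ∈ V) : ∀ᶠ y in 𝓝 z, F y - G y = F z - G z := by
  obtain ⟨r, hr, hrV⟩ := Metric.isOpen_iff.1 hV z hz
  filter_upwards [Metric.ball_mem_nhds z hr] with y hy
  have hd : ∀ x ∈ Metric.ball z r, HasDerivAt (F - G) 0 x := fun x hx => by
    simpa using (hF x (hrV hx)).sub (hG x (hrV hx))
  exact (convex_ball z r).is_const_of_fderivWithin_eq_zero (𝕜 := ℂ) (f := F - G)
    (fun x hx => (hd x hx).differentiableAt.differentiableWithinAt)
    (fun x hx => by
      rw [fderivWithin_of_isOpen Metric.isOpen_ball hx]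
      ext
      simpa using (hd x hx).deriv) hy (Metric.mem_ball_self hr)

/-- The complex numbers with the discrete topology: the possible values at a given point of a
primitive of a given function. -/
@[ext]
structure DiscreteComplex where
  /-- The underlying complex number. -/
  val : ℂ

instance : TopologicalSpace DiscreteComplex := ⊥

instance : DiscreteTopology DiscreteComplex := ⟨rfl⟩

/-- The bundle over `U` whose points over `x` are the germs at `x` of primitives of `f`, given
primitives `P i` of `f` on the members `V i` of an open cover. In the chart `i` a germ `F` at `x` has
the coordinate `F x - P i x`. The fibre is discrete because the germs of one primitive at nearby
points have the same coordinate. -/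
def primitiveBundleCore {U : Set ℂ} (f : ℂ → ℂ) (V : U → Set ℂ) (P : U → ℂ → ℂ)
    (hV : ∀ i, IsOpen (V i)) (hiV : ∀ i, (i : ℂ) ∈ V i)
    (hP : ∀ i, ∀ z ∈ V i, HasDerivAt (P i) (f z) z) :
    FiberBundleCore U U DiscreteComplex where
  baseSet i := Subtype.val ⁻¹' V i
  isOpen_baseSet i := (hV i).preimage continuous_subtype_val
  indexAt := id
  mem_baseSet_at := hiV
  coordChange i j x v := ⟨v.val + (P i x - P j x)⟩
  coordChange_self i x _ v := by simp
  continuousOn_coordChange i j := by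
    rintro ⟨x, v⟩ ⟨⟨hi, hj⟩, -⟩
    have hloc := eventually_sub_eq_of_hasDerivAt ((hV i).inter (hV j))
      (fun z hz => hP i z hz.1) (fun z hz => hP j z hz.2) (z := x) ⟨hi, hj⟩
    refine ContinuousAt.continuousWithinAt ?_
    refine tendsto_nhds_of_eventually_eq ?_
    have h1 : ∀ᶠ p : U × DiscreteComplex in 𝓝 (x, v), p.2 = v :=
      (continuous_snd.tendsto (x, v)).eventually_mem
        (mem_nhds_discrete.2 (Set.mem_singleton v))
    have h2 : ∀ᶠ p : U × DiscreteComplex in 𝓝 (x, v), P i p.1 - P j p.1 = P i x - P j x :=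
      ((continuous_subtype_val.comp continuous_fst).tendsto (x, v)).eventually hloc
    filter_upwards [h1, h2] with p hp1 hp2
    rw [hp1, hp2]
  coordChange_comp i j k x _ v := by
    ext
    ring

/-- A holomorphic function on a simply connected open set has a primitive there: the germs of its
primitives form a covering space, which has a global section. -/
theorem DifferentiableOn.isExactOn_of_isSimplyConnected {U : Set ℂ} {f : ℂ → ℂ}
    (hf : DifferentiableOn ℂ f U) (hUo : IsOpen U) (hUc : IsSimplyConnected U) :
    Complex.IsExactOn f U := by
  classical
  have := hUc.simplyConnectedSpace
  have := hUo.locallyPathConnectedSpace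
  have hex : ∀ i : U, ∃ r > 0, Metric.ball (i : ℂ) r ⊆ U := fun i => Metric.isOpen_iff.1 hUo i i.2
  choose r hr hrU using hex
  choose P hP using fun i : U => (hf.mono (hrU i)).isExactOn_ball
  let Z := primitiveBundleCore f (fun i => Metric.ball (i : ℂ) (r i)) P
    (fun i => Metric.isOpen_ball) (fun i => Metric.mem_ball_self (hr i)) hP
  obtain ⟨x₀, hx₀⟩ := hUc.nonempty
  have hcov : IsCoveringMap (Bundle.TotalSpace.proj (F := DiscreteComplex) (E := Z.Fiber)) :=
    FiberBundle.isCoveringMap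
  obtain ⟨s, ⟨-, hs⟩, -⟩ := hcov.existsUnique_continuousMap_lifts (ContinuousMap.id U) ⟨x₀, hx₀⟩
    ⟨⟨x₀, hx₀⟩, ⟨0⟩⟩ rfl
  have hs1 : ∀ x : U, (s x).1 = x := fun x => congrFun hs x
  -- The value at `x` of the germ `s x`. Near `x` it is `P x` plus a constant, by `key`.
  let S : U → ℂ := fun x => P x x + DiscreteComplex.val (s x).2
  have key : ∀ x : U, ∀ᶠ y : U in 𝓝 x, S y = P x y + DiscreteComplex.val (s x).2 := by
    intro x
    have hsrc : s x ∈ (Z.localTriv x).source := by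
      change (s x).1 ∈ Z.baseSet x
      rw [hs1]
      exact Metric.mem_ball_self (hr x)
    have hc : ContinuousAt (fun y => (Z.localTriv x (s y)).2) x :=
      continuous_snd.continuousAt.comp
        (((Z.localTriv x).continuousAt hsrc).comp s.continuous.continuousAt)
    have hev : ∀ᶠ y in 𝓝 x, (Z.localTriv x (s y)).2 = (Z.localTriv x (s x)).2 :=
      hc.preimage_mem_nhds (mem_nhds_discrete.2 (Set.mem_singleton _))
    have hval : ∀ y : U, (Z.localTriv x (s y)).2.val =
        (DiscreteComplex.val (s y).2 + (P y y - P x y) : ℂ) := by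
      intro y
      change DiscreteComplex.val (s y).2 + (P (s y).1 (s y).1 - P x (s y).1) = _
      rw [hs1]
    filter_upwards [hev] with y hy
    have hy' := congrArg DiscreteComplex.val hy
    rw [hval, hval, sub_self, add_zero] at hy'
    rw [← hy']
    ring
  refine ⟨fun z => if hz : z ∈ U then S ⟨z, hz⟩ else 0, fun z hz => ?_⟩
  have h1 := (hP ⟨z, hz⟩ z (Metric.mem_ball_self (hr ⟨z, hz⟩))).add_const
    (DiscreteComplex.val (s ⟨z, hz⟩).2)
  refine h1.congr_of_eventuallyEq ?_
  have h2 := key ⟨z, hz⟩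
  rw [nhds_subtype_eq_comap, eventually_comap] at h2
  filter_upwards [h2, hUo.mem_nhds hz] with y hy hyU
  rw [dif_pos hyU]
  exact hy ⟨y, hyU⟩ rfl

/-! ### The logarithm along a contour -/

theorem cutLog_ofReal {a : ℝ} (ha : 0 < a) : cutLog a = (Real.log a : ℂ) := by
  simp [cutLog, Complex.arg_ofReal_of_nonneg ha.le, abs_of_pos ha]

theorem cutLog_of_im_pos {z : ℂ} (hz : 0 < z.im) : cutLog z = Complex.log z := by
  rw [cutLog, if_pos (Complex.arg_nonneg_iff.2 hz.le), Complex.log]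

theorem cutLog_of_im_neg {z : ℂ} (hz : z.im < 0) :
    cutLog z = Complex.log z + 2 * Real.pi * Complex.I := by
  rw [cutLog, if_neg (not_le.2 (Complex.arg_neg_iff.2 hz)), Complex.log]
  push_cast
  ring

theorem cutLog_eq_log_neg {z : ℂ} (hz : -z ∈ Complex.slitPlane) :
    cutLog z = Complex.log (-z) + Real.pi * Complex.I := by
  rcases lt_trichotomy z.im 0 with h | h | h
  · rw [cutLog_of_im_neg h, Complex.log, Complex.log, Complex.arg_neg_eq_arg_add_pi_of_im_neg h,
      norm_neg]
    push_cast
    ring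
  · have hre : z.re < 0 := by
      rcases hz with hz | hz
      · simpa using hz
      · simp [h] at hz
    have hz' : z = (z.re : ℂ) := by apply Complex.ext <;> simp [h]
    rw [hz', cutLog, Complex.log, Complex.arg_ofReal_of_neg hre, ← Complex.ofReal_neg,
      Complex.arg_ofReal_of_nonneg (by linarith), if_pos Real.pi_pos.le]
    simp
  · rw [cutLog_of_im_pos h, Complex.log, Complex.log, Complex.arg_neg_eq_arg_sub_pi_of_im_pos h,
      norm_neg]
    push_cast
    ring

/-- Off the cut `[0, ∞)`, that is for `-z` in the slit plane, `cutLog` is a holomorphic logarithm. -/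
theorem hasDerivAt_cutLog {z : ℂ} (hz : -z ∈ Complex.slitPlane) : HasDerivAt cutLog z⁻¹ z := by
  have h1 : HasDerivAt (fun z => Complex.log (-z) + Real.pi * Complex.I) z⁻¹ z := by
    simpa using ((hasDerivAt_neg z).clog hz).add_const (Real.pi * Complex.I : ℂ)
  refine h1.congr_of_eventuallyEq ?_
  filter_upwards [(Complex.isOpen_slitPlane.preimage continuous_neg).mem_nhds hz] with y hy
  exact cutLog_eq_log_neg hy

theorem neg_mem_slitPlane_of_forall_ne {z : ℂ} (hz : ∀ x : ℝ, 0 ≤ x → z ≠ (x : ℂ)) :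
    -z ∈ Complex.slitPlane := by
  rw [Complex.mem_slitPlane_iff]
  by_contra! h
  simp only [Complex.neg_re, Complex.neg_im, neg_eq_zero, Left.neg_nonpos_iff] at h
  exact hz z.re h.1 (by apply Complex.ext <;> simp [h.2])

/-- The logarithm along a contour that goes once around the cut of `cutLog`: it is `cutLog`, except
that at the final point it takes the limit `ln a + 2πi` from the lower side of the cut. -/
noncomputable def contourLog {z w : ℂ} (γ : Path z w) (t : ℝ) : ℂ :=
  if t < 1 then cutLog (γ.extend t) else cutLog (γ.extend t) + 2 * Real.pi * Complex.I

theorem contourLog_zero {a : ℝ} (ha : 0 < a) (γ : Path (a : ℂ) (a : ℂ)) :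
    contourLog γ 0 = (Real.log a : ℂ) := by
  simp [contourLog, cutLog_ofReal ha]

theorem contourLog_one {a : ℝ} (ha : 0 < a) (γ : Path (a : ℂ) (a : ℂ)) :
    contourLog γ 1 = (Real.log a : ℂ) + 2 * Real.pi * Complex.I := by
  simp [contourLog, cutLog_ofReal ha]

theorem contourIntegral_eq {z w : ℂ} (γ : Path z w) (g : ℂ → ℂ) :
    contourIntegral γ g = ∫ t in (0 : ℝ)..1, g (γ.extend t) * deriv γ.extend t := by
  rw [contourIntegral, curveIntegral_eq_intervalIntegral_deriv]
  simp [mul_comm]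

namespace IsStraddlingContour

variable {k : ℂ → ℂ} {a : ℝ} {γ : Path (a : ℂ) (a : ℂ)}

theorem neg_mem_slitPlane (h : IsStraddlingContour k a γ) {t : ℝ} (ht : t ∈ Set.Ioo (0 : ℝ) 1) :
    -γ.extend t ∈ Complex.slitPlane :=
  neg_mem_slitPlane_of_forall_ne (h.avoids_cut t ht)

theorem ne_zero (h : IsStraddlingContour k a γ) (ha : 0 < a) {t : ℝ}
    (ht : t ∈ Set.Icc (0 : ℝ) 1) : γ.extend t ≠ 0 := by
  rcases eq_or_lt_of_le ht.1 with rfl | h0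
  · simpa using ha.ne'
  rcases eq_or_lt_of_le ht.2 with rfl | h1
  · simpa using ha.ne'
  · exact_mod_cast h.avoids_cut t ⟨h0, h1⟩ 0 le_rfl

theorem continuousOn_contourLog (h : IsStraddlingContour k a γ) (ha : 0 < a) :
    ContinuousOn (contourLog γ) (Set.Icc 0 1) := by
  have hγ : Continuous γ.extend := γ.continuous_extend
  have hlog : ContinuousAt Complex.log (a : ℂ) :=
    continuousAt_clog (Complex.ofReal_mem_slitPlane.2 ha)
  -- At the end points the contour approaches `a` from one side of the cut, where `cutLog` is the
  -- principal branch or its translate by `2πi`; the principal branch is continuous at `a`.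
  have hne0 : (𝓝[≥] (0 : ℝ)) = 𝓝[>] 0 ⊔ pure 0 := by
    rw [← Set.Ioi_union_left, nhdsWithin_union, nhdsWithin_singleton]
  have hne1 : (𝓝[≤] (1 : ℝ)) = 𝓝[<] 1 ⊔ pure 1 := by
    rw [← Set.Iio_union_right, nhdsWithin_union, nhdsWithin_singleton]
  intro t ht
  rcases eq_or_lt_of_le ht.1 with rfl | h0
  · refine ContinuousWithinAt.mono (t := Set.Ici 0) ?_ Set.Icc_subset_Ici_self
    rw [ContinuousWithinAt, hne0, tendsto_sup]
    refine ⟨?_, tendsto_pure_nhds _ _⟩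
    have h1 : Tendsto (fun t => Complex.log (γ.extend t)) (𝓝[>] 0) (𝓝 (Complex.log a)) := by
      refine hlog.tendsto.comp ((hγ.tendsto' 0 _ (by simp)).mono_left nhdsWithin_le_nhds)
    rw [contourLog_zero ha, Complex.ofReal_log ha.le]
    refine h1.congr' ?_
    filter_upwards [h.starts_above, Ioo_mem_nhdsGT (zero_lt_one' ℝ)] with s hs hs'
    rw [contourLog, if_pos hs'.2, cutLog_of_im_pos hs]
  rcases eq_or_lt_of_le ht.2 with rfl | h1
  · refine ContinuousWithinAt.mono (t := Set.Iic 1) ?_ Set.Icc_subset_Iic_self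
    rw [ContinuousWithinAt, hne1, tendsto_sup]
    refine ⟨?_, tendsto_pure_nhds _ _⟩
    have h1 : Tendsto (fun t => Complex.log (γ.extend t)) (𝓝[<] 1) (𝓝 (Complex.log a)) := by
      refine hlog.tendsto.comp ((hγ.tendsto' 1 _ (by simp)).mono_left nhdsWithin_le_nhds)
    rw [contourLog_one ha, Complex.ofReal_log ha.le]
    refine (h1.add_const _).congr' ?_
    filter_upwards [h.ends_below, Ioo_mem_nhdsLT (zero_lt_one' ℝ)] with s hs hs'
    rw [contourLog, if_pos hs'.2, cutLog_of_im_neg hs]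
  · refine ContinuousAt.continuousWithinAt ?_
    have h2 : ContinuousAt (fun t => cutLog (γ.extend t)) t :=
      ContinuousAt.comp (f := γ.extend)
        (hasDerivAt_cutLog (h.neg_mem_slitPlane ⟨h0, h1⟩)).continuousAt hγ.continuousAt
    refine h2.congr ?_
    filter_upwards [Iio_mem_nhds h1] with s hs
    exact (if_pos (Set.mem_Iio.1 hs)).symm

end IsStraddlingContour

/-! ### Piecewise `C¹` paths -/

/-- The derivative of a piecewise `C¹` function is integrable against a continuous weight. -/
theorem intervalIntegrable_mul_deriv_of_piecewise {c f : ℝ → ℂ} (s : Finset ℝ) :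
    ∀ {p q : ℝ}, p ≤ q → ContinuousOn c (Set.Icc p q) →
      (∀ u v : ℝ, p ≤ u → u < v → v ≤ q → (∀ x ∈ s, x ∉ Set.Ioo u v) →
        ContDiffOn ℝ 1 f (Set.Icc u v)) →
      IntervalIntegrable (fun t => c t * deriv f t) MeasureTheory.volume p q := by
  classical
  induction s using Finset.induction_on with
  | empty =>
    intro p q hpq hc hf
    rcases hpq.eq_or_lt with rfl | hlt
    · simp
    have h1 : ContinuousOn (fun t => c t * derivWithin f (Set.Icc p q) t) (Set.Icc p q) :=
      hc.mul ((hf p q le_rfl hlt le_rfl (by simp)).continuousOn_derivWithin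
        (uniqueDiffOn_Icc hlt) le_rfl)
    have h2 : IntervalIntegrable (fun t => c t * derivWithin f (Set.Icc p q) t)
        MeasureTheory.volume p q := by
      apply ContinuousOn.intervalIntegrable
      rwa [Set.uIcc_of_le hpq]
    refine h2.congr_ae ?_
    rw [Set.uIoc_of_le hpq, ← MeasureTheory.restrict_Ioo_eq_restrict_Ioc]
    filter_upwards [MeasureTheory.ae_restrict_mem measurableSet_Ioo] with x hx
    rw [derivWithin_of_mem_nhds (Icc_mem_nhds hx.1 hx.2)]
  | insert x s _ ih =>
    intro p q hpq hc hf
    by_cases hx : x ∈ Set.Ioo p q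
    · refine (ih hx.1.le (hc.mono (Set.Icc_subset_Icc_right hx.2.le))
        fun u v hu huv hv hs => ?_).trans (ih hx.2.le (hc.mono (Set.Icc_subset_Icc_left hx.1.le))
        fun u v hu huv hv hs => ?_)
      · refine hf u v hu huv (hv.trans hx.2.le) (Finset.forall_mem_insert _ _ _ |>.2 ⟨?_, hs⟩)
        exact fun h => absurd h.2 (not_lt.2 hv)
      · refine hf u v (hx.1.le.trans hu) huv hv (Finset.forall_mem_insert _ _ _ |>.2 ⟨?_, hs⟩)
        exact fun h => absurd h.1 (not_lt.2 hu)
    · refine ih hpq hc fun u v hu huv hv hs =>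
        hf u v hu huv hv (Finset.forall_mem_insert _ _ _ |>.2 ⟨?_, hs⟩)
      exact fun h => hx ⟨hu.trans_lt h.1, h.2.trans_le hv⟩

theorem IsPiecewiseC1.intervalIntegrable_mul_deriv {z w : ℂ} {γ : Path z w}
    (hγ : IsPiecewiseC1 γ) {c : ℝ → ℂ} (hc : ContinuousOn c (Set.Icc 0 1)) :
    IntervalIntegrable (fun t => c t * deriv γ.extend t) MeasureTheory.volume 0 1 := by
  obtain ⟨s, hs⟩ := hγ
  exact intervalIntegrable_mul_deriv_of_piecewise s zero_le_one hc hs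

theorem IsPiecewiseC1.exists_hasDerivAt {z w : ℂ} {γ : Path z w} (hγ : IsPiecewiseC1 γ) :
    ∃ s : Finset ℝ, ∀ t ∈ Set.Ioo (0 : ℝ) 1 \ (s : Set ℝ),
      HasDerivAt γ.extend (deriv γ.extend t) t := by
  obtain ⟨s, hs⟩ := hγ
  refine ⟨s, fun t ht => ?_⟩
  have hmem : Set.Ioo (0 : ℝ) 1 \ (s : Set ℝ) ∈ 𝓝 t :=
    (isOpen_Ioo.sdiff s.finite_toSet.isClosed).mem_nhds ht
  obtain ⟨u, v, hutv, huv⟩ := mem_nhds_iff_exists_Ioo_subset.1 hmem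
  obtain ⟨u', hu'⟩ := exists_between hutv.1
  obtain ⟨v', hv'⟩ := exists_between hutv.2
  have hsub : Set.Icc u' v' ⊆ Set.Ioo (0 : ℝ) 1 \ (s : Set ℝ) := fun x hx =>
    huv ⟨hu'.1.trans_le hx.1, hx.2.trans_lt hv'.2⟩
  have hlt : u' < v' := hu'.2.trans hv'.1
  have h1 := hs u' v' (hsub ⟨le_rfl, hlt.le⟩).1.1.le hlt (hsub ⟨hlt.le, le_rfl⟩).1.2.le
    fun x hx hx' => (hsub ⟨hx'.1.le, hx'.2.le⟩).2 hx
  exact ((h1.differentiableOn one_ne_zero t ⟨hu'.2.le, hv'.1.le⟩).differentiableAt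
    (Icc_mem_nhds hu'.2 hv'.1)).hasDerivAt

/-! ### Integrals of powers of the logarithm along a contour -/

namespace IsStraddlingContour

variable {k : ℂ → ℂ} {a : ℝ} {γ : Path (a : ℂ) (a : ℂ)}

theorem ne_zero_of_mem_range (h : IsStraddlingContour k a γ) (ha : 0 < a) {z : ℂ}
    (hz : z ∈ Set.range γ) : z ≠ 0 := by
  obtain ⟨t, rfl⟩ := hz
  simpa using h.ne_zero ha t.2

theorem continuousOn_polynomial_contourLog (h : IsStraddlingContour k a γ) (ha : 0 < a)
    {g : ℂ → ℂ} (hg : ContinuousOn g (Set.range γ)) (Q : Polynomial ℂ) :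
    ContinuousOn (fun t => g (γ.extend t) * Q.eval (contourLog γ t)) (Set.Icc 0 1) := by
  refine ContinuousOn.mul ?_ (Q.continuous.comp_continuousOn (h.continuousOn_contourLog ha))
  refine hg.comp γ.continuous_extend.continuousOn fun t _ => ?_
  rw [← γ.extend_range]
  exact Set.mem_range_self t

/-- The value of `cutLog` at the final point `a` of the contour is not the limit along the contour;
this matters at one parameter only. -/
theorem intervalIntegrable (h : IsStraddlingContour k a γ) (ha : 0 < a)
    {g : ℂ → ℂ} (hg : ContinuousOn g (Set.range γ)) (Q : Polynomial ℂ) :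
    IntervalIntegrable (fun t => g (γ.extend t) * Q.eval (cutLog (γ.extend t)) *
      deriv γ.extend t) MeasureTheory.volume 0 1 := by
  refine (h.piecewiseC1.intervalIntegrable_mul_deriv
    (h.continuousOn_polynomial_contourLog ha hg Q)).congr_ae ?_
  rw [Set.uIoc_of_le zero_le_one, ← MeasureTheory.restrict_Ioo_eq_restrict_Ioc]
  filter_upwards [MeasureTheory.ae_restrict_mem measurableSet_Ioo] with t ht
  rw [contourLog, if_pos ht.2]

theorem contourIntegral_add (h : IsStraddlingContour k a γ) (ha : 0 < a) {g₁ g₂ : ℂ → ℂ}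
    (hg₁ : ContinuousOn g₁ (Set.range γ)) (hg₂ : ContinuousOn g₂ (Set.range γ))
    (Q₁ Q₂ : Polynomial ℂ) :
    contourIntegral γ (fun z => g₁ z * Q₁.eval (cutLog z) + g₂ z * Q₂.eval (cutLog z)) =
      contourIntegral γ (fun z => g₁ z * Q₁.eval (cutLog z)) +
        contourIntegral γ (fun z => g₂ z * Q₂.eval (cutLog z)) := by
  simp only [contourIntegral_eq, add_mul]
  exact intervalIntegral.integral_add (h.intervalIntegrable ha hg₁ Q₁)
    (h.intervalIntegrable ha hg₂ Q₂)

theorem contourIntegral_const_mul (γ : Path (a : ℂ) (a : ℂ)) (c : ℂ) (g : ℂ → ℂ) :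
    contourIntegral γ (fun z => c * g z) = c * contourIntegral γ g := by
  simp only [contourIntegral_eq, mul_assoc]
  exact intervalIntegral.integral_const_mul _ _

/-- The logarithm along the contour is differentiable wherever the contour is. -/
theorem hasDerivAt_contourLog (h : IsStraddlingContour k a γ) {t : ℝ}
    (ht : t ∈ Set.Ioo (0 : ℝ) 1) {γ' : ℂ} (hγ : HasDerivAt γ.extend γ' t) :
    HasDerivAt (contourLog γ) ((γ.extend t)⁻¹ * γ') t := by
  refine ((hasDerivAt_cutLog (h.neg_mem_slitPlane ht)).comp t hγ).congr_of_eventuallyEq ?_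
  filter_upwards [Iio_mem_nhds ht.2] with s hs
  exact if_pos (Set.mem_Iio.1 hs)

/-- Integration by parts along the contour. The boundary term does not vanish because the logarithm
increases by `2πi`. -/
theorem contourIntegral_by_parts (h : IsStraddlingContour k a γ) (ha : 0 < a) {g₁ g : ℂ → ℂ}
    (hG : ∀ z ∈ Set.range γ, HasDerivAt (fun z => z * g₁ z) (g z) z)
    (hg₁ : ContinuousOn g₁ (Set.range γ)) (hg : ContinuousOn g (Set.range γ)) (Q : Polynomial ℂ) :
    contourIntegral γ (fun z => g z * Q.eval (cutLog z)) =
      a * g₁ a * (Q.eval ((Real.log a : ℂ) + 2 * Real.pi * Complex.I) - Q.eval (Real.log a : ℂ)) -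
        contourIntegral γ (fun z => g₁ z * Q.derivative.eval (cutLog z)) := by
  have hmem : ∀ t, γ.extend t ∈ Set.range γ := fun t => by
    rw [← γ.extend_range]; exact Set.mem_range_self t
  rw [eq_sub_iff_add_eq, ← h.contourIntegral_add ha hg hg₁, contourIntegral_eq]
  obtain ⟨s, hs⟩ := h.piecewiseC1.exists_hasDerivAt
  rw [MeasureTheory.integral_eq_of_hasDerivAt_off_countable_of_le
    (fun t => γ.extend t * g₁ (γ.extend t) * Q.eval (contourLog γ t)) _ zero_le_one
    s.countable_toSet (h.continuousOn_polynomial_contourLog ha (continuousOn_id.mul hg₁) Q)]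
  · simp only [Path.extend_zero, Path.extend_one, contourLog_zero ha, contourLog_one ha]
    ring
  · intro t ht
    have h1 := (hG _ (hmem t)).comp t (hs t ht)
    have h2 := (Q.hasDerivAt (contourLog γ t)).comp t (h.hasDerivAt_contourLog ht.1 (hs t ht))
    refine (h1.mul h2).congr_deriv ?_
    have hne := h.ne_zero ha (Set.Ioo_subset_Icc_self ht.1)
    simp only [Function.comp, contourLog, if_pos ht.1.2]
    field_simp
  · simp only [add_mul]
    exact (h.intervalIntegrable ha hg Q).add (h.intervalIntegrable ha hg₁ _)

theorem contourIntegral_sum (h : IsStraddlingContour k a γ) (ha : 0 < a) {g : ℂ → ℂ}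
    (hg : ContinuousOn g (Set.range γ)) (c : ℕ → ℂ) (s : Finset ℕ) :
    contourIntegral γ (fun z => g z * ∑ j ∈ s, c j * cutLog z ^ j) =
      ∑ j ∈ s, c j * contourIntegral γ (fun z => g z * cutLog z ^ j) := by
  simp only [contourIntegral_eq, ← intervalIntegral.integral_const_mul]
  rw [← intervalIntegral.integral_finsetSum]
  · refine intervalIntegral.integral_congr fun t _ => ?_
    simp only [Finset.mul_sum, Finset.sum_mul]
    exact Finset.sum_congr rfl fun j _ => by ring
  · intro j _
    have h1 := (h.intervalIntegrable ha hg (Polynomial.X ^ j)).const_mul (c j)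
    simpa [mul_assoc] using h1

end IsStraddlingContour

/-! ### Calculus of finite parts -/

theorem HasFinitePart.add {f g : ℝ → ℂ} {a : ℝ} (ha : 0 < a) {L M : ℂ}
    (hf : HasFinitePart f a L) (hg : HasFinitePart g a M) :
    HasFinitePart (fun t => f t + g t) a (L + M) := by
  obtain ⟨hfi, D, hD, hfl⟩ := hf
  obtain ⟨hgi, E, hE, hgl⟩ := hg
  refine ⟨fun ε hε => (hfi ε hε).add (hgi ε hε), D + E, Submodule.add_mem _ hD hE, ?_⟩
  refine (hfl.add hgl).congr' ?_
  filter_upwards [Ioo_mem_nhdsGT ha] with ε hε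
  rw [intervalIntegral.integral_add (hfi ε hε) (hgi ε hε), Pi.add_apply]
  ring

theorem HasFinitePart.const_mul {f : ℝ → ℂ} {a : ℝ} {L : ℂ} (c : ℂ) (hf : HasFinitePart f a L) :
    HasFinitePart (fun t => c * f t) a (c * L) := by
  obtain ⟨hfi, D, hD, hfl⟩ := hf
  refine ⟨fun ε hε => (hfi ε hε).const_mul c, c • D, Submodule.smul_mem _ c hD, ?_⟩
  refine (hfl.const_mul c).congr fun ε => ?_
  rw [intervalIntegral.integral_const_mul, Pi.smul_apply, smul_eq_mul, mul_sub]

theorem HasFinitePart.congr {f g : ℝ → ℂ} {a : ℝ} (ha : 0 < a) {L : ℂ} (hf : HasFinitePart f a L)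
    (h : ∀ t ∈ Set.Ioc 0 a, f t = g t) : HasFinitePart g a L := by
  obtain ⟨hfi, D, hD, hfl⟩ := hf
  have hEq : ∀ ε ∈ Set.Ioo 0 a, Set.EqOn f g (Set.uIoc ε a) := fun ε hε t ht => by
    rw [Set.uIoc_of_le hε.2.le] at ht
    exact h t ⟨hε.1.trans ht.1, ht.2⟩
  refine ⟨fun ε hε => (hfi ε hε).congr (hEq ε hε), D, hD, hfl.congr' ?_⟩
  filter_upwards [Ioo_mem_nhdsGT ha] with ε hε
  rw [intervalIntegral.integral_congr_ae (Eventually.of_forall (hEq ε hε))]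

/-- The fundamental theorem of calculus for finite parts: the primitive is evaluated at the left end
point by discarding its divergent part there. -/
theorem hasFinitePart_of_hasDerivAt {F f D : ℝ → ℂ} {a : ℝ} (ha : 0 < a) {c : ℂ}
    (hF : ∀ t ∈ Set.Ioc 0 a, HasDerivAt F (f t) t) (hf : ContinuousOn f (Set.Ioc 0 a))
    (hD : D ∈ divergentParts) (hc : Tendsto (fun ε => F ε - D ε) (𝓝[>] 0) (𝓝 c)) :
    HasFinitePart f a (F a - c) := by
  have hint : ∀ ε ∈ Set.Ioo 0 a, IntervalIntegrable f MeasureTheory.volume ε a := fun ε hε => by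
    refine (hf.mono ?_).intervalIntegrable
    rw [Set.uIcc_of_le hε.2.le]
    exact fun t ht => ⟨hε.1.trans_le ht.1, ht.2⟩
  refine ⟨hint, -D, Submodule.neg_mem _ hD, ?_⟩
  refine (hc.const_sub (F a)).congr' ?_
  filter_upwards [Ioo_mem_nhdsGT ha] with ε hε
  rw [intervalIntegral.integral_eq_sub_of_hasDerivAt (f := F) ?_ (hint ε hε), Pi.neg_apply]
  · ring
  · intro t ht
    rw [Set.uIcc_of_le hε.2.le] at ht
    exact hF t ⟨hε.1.trans_le ht.1, ht.2⟩

theorem inv_pow_mul_log_mem_divergentParts (m : ℕ) (q : Polynomial ℂ) (h : 0 < m ∨ q.coeff 0 = 0) :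
    (fun ε : ℝ => ((ε : ℂ) ^ m)⁻¹ * q.eval (Real.log ε : ℂ)) ∈ divergentParts := by
  have hsum : (fun ε : ℝ => ((ε : ℂ) ^ m)⁻¹ * q.eval (Real.log ε : ℂ)) =
      ∑ p ∈ Finset.range (q.natDegree + 1), q.coeff p • divergentTerm ((m : ℝ), p) := by
    ext ε
    rw [Polynomial.eval_eq_sum_range, Finset.mul_sum, Finset.sum_apply]
    refine Finset.sum_congr rfl fun p _ => ?_
    have hpow : ε ^ (-(m : ℝ)) = (ε ^ m)⁻¹ := by
      rw [← Int.cast_natCast, ← Int.cast_neg, Real.rpow_intCast, zpow_neg, zpow_natCast]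
    simp only [Pi.smul_apply, smul_eq_mul, divergentTerm, hpow]
    push_cast
    ring
  rw [hsum]
  refine Submodule.sum_mem _ fun p _ => ?_
  by_cases hp : 0 < m ∨ 0 < p
  · refine Submodule.smul_mem _ _ (Submodule.subset_span ⟨_, ?_, rfl⟩)
    rcases Nat.eq_zero_or_pos m with rfl | hm
    · exact Or.inr ⟨by simp, by simpa using hp⟩
    · exact Or.inl (by simpa using hm)
  · push Not at hp
    have hp0 : p = 0 := by omega
    have hm0 : ¬ 0 < m := by omega
    simp [hp0, h.resolve_left hm0]

theorem tendsto_mul_log_pow_nhdsGT_zero (p : ℕ) :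
    Tendsto (fun ε : ℝ => ε * Real.log ε ^ p) (𝓝[>] 0) (𝓝 0) := by
  have h1 : Tendsto (fun ε => -Real.log ε) (𝓝[>] 0) atTop :=
    tendsto_neg_atBot_atTop.comp Real.tendsto_log_nhdsGT_zero
  have h2 := ((Real.tendsto_pow_mul_exp_neg_atTop_nhds_zero p).comp h1).const_mul ((-1) ^ p)
  rw [mul_zero] at h2
  refine h2.congr' ?_
  filter_upwards [self_mem_nhdsWithin] with ε hε
  simp only [Function.comp, neg_neg, Real.exp_log hε]
  rw [← mul_assoc, ← mul_pow]
  ring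

theorem tendsto_mul_polynomial_log {g : ℂ → ℂ} (hg : ContinuousAt g 0) (q : Polynomial ℂ) :
    Tendsto (fun ε : ℝ => (ε : ℂ) * g ε * q.eval (Real.log ε : ℂ)) (𝓝[>] 0) (𝓝 0) := by
  have h0 : Tendsto (fun ε : ℝ => g ε) (𝓝[>] 0) (𝓝 (g 0)) :=
    hg.tendsto.comp ((Complex.continuous_ofReal.tendsto' 0 0 (by simp)).mono_left nhdsWithin_le_nhds)
  have h1 : Tendsto (fun ε : ℝ => ∑ p ∈ Finset.range (q.natDegree + 1),
      q.coeff p * ((ε * Real.log ε ^ p : ℝ) : ℂ) * g ε) (𝓝[>] 0)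
      (𝓝 (∑ p ∈ Finset.range (q.natDegree + 1), q.coeff p * ((0 : ℝ) : ℂ) * g 0)) := by
    refine tendsto_finsetSum _ fun p _ => Tendsto.mul ?_ h0
    exact ((Complex.continuous_ofReal.tendsto _).comp
      (tendsto_mul_log_pow_nhdsGT_zero p)).const_mul _
  simp only [Complex.ofReal_zero, mul_zero, zero_mul, Finset.sum_const_zero] at h1
  refine h1.congr fun ε => ?_
  rw [Polynomial.eval_eq_sum_range, Finset.mul_sum]
  refine Finset.sum_congr rfl fun p _ => ?_
  push_cast
  ring

theorem hasDerivAt_polynomial_log (q : Polynomial ℂ) {t : ℝ} (ht : t ≠ 0) :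
    HasDerivAt (fun t : ℝ => q.eval (Real.log t : ℂ))
      (q.derivative.eval (Real.log t : ℂ) * (t : ℂ)⁻¹) t := by
  have h1 := (q.hasDerivAt (Real.log t : ℂ)).comp t (Real.hasDerivAt_log ht).ofReal_comp
  exact h1.congr_deriv (by push_cast; rfl)

theorem continuousOn_polynomial_log (q : Polynomial ℂ) (a : ℝ) :
    ContinuousOn (fun t : ℝ => q.eval (Real.log t : ℂ)) (Set.Ioc 0 a) := fun _ ht =>
  (hasDerivAt_polynomial_log q ht.1.ne').continuousAt.continuousWithinAt

/-- Integration by parts for finite parts, when the boundary term at `0` is a divergent part up to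
a term that tends to `0`. -/
theorem HasFinitePart.by_parts {a : ℝ} (ha : 0 < a) {g₁ g : ℂ → ℂ} {D : ℝ → ℂ}
    {q : Polynomial ℂ} {L : ℂ}
    (hG : ∀ t ∈ Set.Ioc 0 a, HasDerivAt (fun z : ℂ => z * g₁ z) (g t) t)
    (hg₁ : ContinuousOn (fun t : ℝ => g₁ t) (Set.Ioc 0 a))
    (hg : ContinuousOn (fun t : ℝ => g t) (Set.Ioc 0 a)) (hD : D ∈ divergentParts)
    (hlim : Tendsto (fun ε : ℝ => (ε : ℂ) * g₁ ε * q.eval (Real.log ε : ℂ) - D ε) (𝓝[>] 0) (𝓝 0))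
    (h : HasFinitePart (fun t => g₁ t * q.derivative.eval (Real.log t : ℂ)) a L) :
    HasFinitePart (fun t => g t * q.eval (Real.log t : ℂ)) a
      (a * g₁ a * q.eval (Real.log a : ℂ) - L) := by
  have h1 : HasFinitePart (fun t => g t * q.eval (Real.log t : ℂ) +
      g₁ t * q.derivative.eval (Real.log t : ℂ)) a
      ((a : ℂ) * g₁ a * q.eval (Real.log a : ℂ) - 0) := by
    refine hasFinitePart_of_hasDerivAt
      (F := fun t => (t : ℂ) * g₁ t * q.eval (Real.log t : ℂ)) ha (fun t ht => ?_) ?_ hD hlim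
    · have hne : (t : ℂ) ≠ 0 := by exact_mod_cast ht.1.ne'
      refine ((hG t ht).comp_ofReal.mul (hasDerivAt_polynomial_log q ht.1.ne')).congr_deriv ?_
      field_simp
    · exact (hg.mul (continuousOn_polynomial_log q a)).add
        (hg₁.mul (continuousOn_polynomial_log _ a))
  have h2 := (h1.add ha (h.const_mul (-1))).congr ha
    (g := fun t => g t * q.eval (Real.log t : ℂ)) fun t _ => by ring
  convert h2 using 1
  ring

/-! ### Finite parts as contour integrals -/

/-- The increment `q(X + 2πi) - q(X)` of a polynomial over one turn of the logarithm. -/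
noncomputable def turnDiff (q : Polynomial ℂ) : Polynomial ℂ :=
  q.comp (Polynomial.X + Polynomial.C (2 * Real.pi * Complex.I)) - q

theorem eval_turnDiff (q : Polynomial ℂ) (x : ℂ) :
    (turnDiff q).eval x = q.eval (x + 2 * Real.pi * Complex.I) - q.eval x := by
  simp [turnDiff]

theorem derivative_turnDiff (q : Polynomial ℂ) :
    (turnDiff q).derivative = turnDiff q.derivative := by
  simp [turnDiff, Polynomial.derivative_comp]

/-- The jump of `g(z) R'(log z)` across the cut has a finite part over `[0, a]`, and it is given by
the integral of `g(z) R'(log z)` along `γ`, up to the residue term `c (R(2πi) - R(0))`. Here `c`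
stands for the residue of `g` at `0`, and the increment of `R` is the integral of `R'` from `0` to
`2πi`, the contribution of `1 / z` on a small circle. -/
def HasJumpFormula {a : ℝ} (γ : Path (a : ℂ) (a : ℂ)) (g : ℂ → ℂ) (c : ℂ) : Prop :=
  ∀ R : Polynomial ℂ, HasFinitePart
    (fun t => g t * (turnDiff R.derivative).eval (Real.log t : ℂ)) a
    (contourIntegral γ (fun z => g z * R.derivative.eval (cutLog z)) - c * (turnDiff R).eval 0)

section

variable {k : ℂ → ℂ} {a : ℝ} {γ : Path (a : ℂ) (a : ℂ)} {g g₁ g₂ : ℂ → ℂ} {c c₁ c₂ : ℂ}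

theorem contourIntegral_congr {g₁ g₂ : ℂ → ℂ} (h : ∀ z ∈ Set.range γ, g₁ z = g₂ z) :
    contourIntegral γ g₁ = contourIntegral γ g₂ := by
  simp only [contourIntegral_eq]
  refine intervalIntegral.integral_congr fun t _ => ?_
  have hmem : γ.extend t ∈ Set.range γ := by
    rw [← γ.extend_range]; exact Set.mem_range_self t
  simp only [h _ hmem]

theorem HasJumpFormula.congr (h : HasJumpFormula γ g₁ c) (hγ : IsStraddlingContour k a γ)
    (ha : 0 < a) (heq : ∀ z ≠ 0, g₁ z = g₂ z) : HasJumpFormula γ g₂ c := by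
  intro R
  have h1 := (h R).congr ha
    (g := fun t => g₂ t * (turnDiff R.derivative).eval (Real.log t : ℂ)) fun t ht => by
      rw [heq t (by exact_mod_cast ht.1.ne')]
  rwa [contourIntegral_congr (γ := γ) (g₂ := fun z => g₂ z * R.derivative.eval (cutLog z))
    fun z hz => by rw [heq z (hγ.ne_zero_of_mem_range ha hz)]] at h1

theorem HasJumpFormula.add (h₁ : HasJumpFormula γ g₁ c₁) (h₂ : HasJumpFormula γ g₂ c₂)
    (hγ : IsStraddlingContour k a γ) (ha : 0 < a) (hg₁ : ContinuousOn g₁ (Set.range γ))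
    (hg₂ : ContinuousOn g₂ (Set.range γ)) :
    HasJumpFormula γ (fun z => g₁ z + g₂ z) (c₁ + c₂) := by
  intro R
  have h := (h₁ R).add ha (h₂ R)
  simp only [add_mul]
  rw [hγ.contourIntegral_add ha hg₁ hg₂]
  convert h using 1
  ring

theorem HasJumpFormula.const_mul (h : HasJumpFormula γ g c) (d : ℂ) :
    HasJumpFormula γ (fun z => d * g z) (d * c) := by
  intro R
  have h1 := (h R).const_mul d
  simp only [mul_assoc] at h1 ⊢
  rw [IsStraddlingContour.contourIntegral_const_mul]
  convert h1 using 1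
  ring

/-- Integration by parts on both sides reduces the jump formula to a polynomial of lower degree.
Hence it holds, without a residue term, for all members of a class of functions that is closed under
`g ↦ g₁` with `(z g₁)' = g`, if the boundary terms at `0` have no finite part. -/
theorem hasJumpFormula_zero_of_closed (hγ : IsStraddlingContour k a γ) (ha : 0 < a)
    (𝒢 : Set (ℂ → ℂ))
    (hcont : ∀ g ∈ 𝒢, ContinuousOn g (Set.range γ) ∧
      ContinuousOn (fun t : ℝ => g t) (Set.Ioc 0 a))
    (hprim : ∀ g ∈ 𝒢, ∃ g₁ ∈ 𝒢, (∀ z ∈ Set.range γ, HasDerivAt (fun z => z * g₁ z) (g z) z) ∧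
      (∀ t ∈ Set.Ioc 0 a, HasDerivAt (fun z : ℂ => z * g₁ z) (g t) t) ∧
      ∀ q : Polynomial ℂ, ∃ D ∈ divergentParts, Tendsto
        (fun ε : ℝ => (ε : ℂ) * g₁ ε * q.eval (Real.log ε : ℂ) - D ε) (𝓝[>] 0) (𝓝 0))
    (hg : g ∈ 𝒢) : HasJumpFormula γ g 0 := by
  suffices H : ∀ (N : ℕ) (Q : Polynomial ℂ), Q.natDegree < N → ∀ g ∈ 𝒢,
      HasFinitePart (fun t => g t * (turnDiff Q).eval (Real.log t : ℂ)) a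
        (contourIntegral γ (fun z => g z * Q.eval (cutLog z))) by
    intro R
    simpa using H _ R.derivative (Nat.lt_succ_self _) g hg
  intro N
  induction N with
  | zero => exact fun Q hQ => absurd hQ (Nat.not_lt_zero _)
  | succ N ih =>
    intro Q hQ g hg
    obtain ⟨g₁, hg₁, hd, hd', hD⟩ := hprim g hg
    obtain ⟨D, hDm, hDl⟩ := hD (turnDiff Q)
    have hlow : HasFinitePart (fun t => g₁ t * (turnDiff Q.derivative).eval (Real.log t : ℂ)) a
        (contourIntegral γ (fun z => g₁ z * Q.derivative.eval (cutLog z))) := by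
      rcases Nat.eq_zero_or_pos Q.natDegree with h0 | hpos
      · have hQ' : Q.derivative = 0 := Polynomial.derivative_of_natDegree_zero h0
        refine ⟨fun ε _ => ?_, 0, Submodule.zero_mem _, ?_⟩
        · simp [hQ', turnDiff]
        · simp [hQ', turnDiff, contourIntegral_eq]
      · exact ih _ (by have := Polynomial.natDegree_derivative_lt hpos.ne'; omega) g₁ hg₁
    rw [hγ.contourIntegral_by_parts ha hd (hcont g₁ hg₁).1 (hcont g hg).1, ← eval_turnDiff]
    refine HasFinitePart.by_parts ha hd' (hcont g₁ hg₁).2 (hcont g hg).2 hDm hDl ?_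
    rwa [derivative_turnDiff]

theorem hasJumpFormula_of_differentiableOn (hγ : IsStraddlingContour k a γ) (ha : 0 < a)
    {U : Set ℂ} (hUo : IsOpen U) (hUc : IsSimplyConnected U)
    (haU : (fun t : ℝ => (t : ℂ)) '' Set.Icc 0 a ⊆ U) (hγU : Set.range γ ⊆ U)
    (hg : DifferentiableOn ℂ g U) : HasJumpFormula γ g 0 := by
  have haU' : ∀ t ∈ Set.Icc 0 a, (t : ℂ) ∈ U := fun t ht => haU ⟨t, ht, rfl⟩
  have h0U : U ∈ 𝓝 (0 : ℂ) := hUo.mem_nhds (by simpa using haU' 0 ⟨le_rfl, ha.le⟩)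
  refine hasJumpFormula_zero_of_closed hγ ha {g | DifferentiableOn ℂ g U} (fun g hg =>
    ⟨hg.continuousOn.mono hγU, hg.continuousOn.comp Complex.continuous_ofReal.continuousOn
      fun t ht => haU' t (Set.Ioc_subset_Icc_self ht)⟩) (fun g hg => ?_) hg
  -- With `G` the primitive of `g` that vanishes at `0`, the function `g₁ = G / z` is analytic, and
  -- the boundary term `G(ε) q(ln ε)` tends to `0`.
  obtain ⟨G, hG0, hG⟩ := (DifferentiableOn.isExactOn_of_isSimplyConnected hg hUo hUc).with_val_at
    0 0
  have hmul : (fun z => z * dslope G 0 z) = G := by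
    ext z
    simpa [hG0] using sub_smul_dslope G 0 z
  have hdiff : DifferentiableOn ℂ (dslope G 0) U := (Complex.differentiableOn_dslope h0U).2
    fun z hz => (hG z hz).differentiableAt.differentiableWithinAt
  refine ⟨dslope G 0, hdiff, ?_, ?_, fun q => ⟨0, Submodule.zero_mem _, ?_⟩⟩
  · rw [hmul]; exact fun z hz => hG z (hγU hz)
  · rw [hmul]; exact fun t ht => hG t (haU' t (Set.Ioc_subset_Icc_self ht))
  · simpa using tendsto_mul_polynomial_log (hdiff.continuousOn.continuousAt h0U) q

/-- For `g = d z ^ (-p)` with `p ≥ 2`, one has `g₁ = d / (1 - p) z ^ (-p)`, and the boundary term at `0`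
is a divergent part. -/
theorem hasJumpFormula_inv_pow (hγ : IsStraddlingContour k a γ) (ha : 0 < a) (m : ℕ) :
    HasJumpFormula γ (fun z => (z ^ (m + 2))⁻¹) 0 := by
  have hcont : ∀ d : ℂ, ∀ z ≠ 0, ContinuousAt (fun z : ℂ => d * (z ^ (m + 2))⁻¹) z := fun d z hz =>
    continuousAt_const.mul ((continuousAt_id.pow _).inv₀ (pow_ne_zero _ hz))
  have hd : ∀ d : ℂ, ∀ z ≠ 0, HasDerivAt (fun z : ℂ => z * (-d / (m + 1) * (z ^ (m + 2))⁻¹))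
      (d * (z ^ (m + 2))⁻¹) z := fun d z hz => by
    have hm : (m + 1 : ℂ) ≠ 0 := Nat.cast_add_one_ne_zero m
    refine ((hasDerivAt_id z).mul ((((hasDerivAt_pow (m + 2) z).inv
      (pow_ne_zero _ hz))).const_mul (-d / (m + 1)))).congr_deriv ?_
    simp only [id, Pi.inv_apply]
    push_cast
    field_simp
    ring
  have key := hasJumpFormula_zero_of_closed hγ ha
    {g | ∃ d : ℂ, g = fun z => d * (z ^ (m + 2))⁻¹} ?_ ?_ (g := fun z => 1 * (z ^ (m + 2))⁻¹) ⟨1, rfl⟩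
  · simpa using key
  · rintro _ ⟨d, rfl⟩
    refine ⟨fun z hz => (hcont d z (hγ.ne_zero_of_mem_range ha hz)).continuousWithinAt,
      fun t ht => ContinuousAt.continuousWithinAt ?_⟩
    exact ContinuousAt.comp (f := fun t : ℝ => (t : ℂ)) (hcont d t (by exact_mod_cast ht.1.ne'))
      Complex.continuous_ofReal.continuousAt
  · rintro _ ⟨d, rfl⟩
    refine ⟨_, ⟨-d / (m + 1), rfl⟩, fun z hz => hd d z (hγ.ne_zero_of_mem_range ha hz),
      fun t ht => hd d t (by exact_mod_cast ht.1.ne'), fun q => ⟨_, Submodule.smul_mem _ (-d / (m + 1))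
        (inv_pow_mul_log_mem_divergentParts (m + 1) q (Or.inl m.succ_pos)), ?_⟩⟩
    refine tendsto_const_nhds.congr' ?_
    filter_upwards [self_mem_nhdsWithin] with ε hε
    have hne : (ε : ℂ) ≠ 0 := by exact_mod_cast (Set.mem_Ioi.1 hε).ne'
    simp only [Pi.smul_apply, smul_eq_mul]
    field_simp
    ring

/-- The function `1 / z` is the one with a residue: `R(log z)` is a primitive of `R'(log z) / z`, and
its jump `R(ln t + 2πi) - R(ln t)` has the finite part `R(2πi) - R(0)` at `0`. -/
theorem hasJumpFormula_inv (hγ : IsStraddlingContour k a γ) (ha : 0 < a) :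
    HasJumpFormula γ (fun z => z⁻¹) 1 := by
  intro R
  have hd : ∀ z : ℂ, z ≠ 0 → HasDerivAt (fun z : ℂ => z * z⁻¹) 0 z := fun z hz => by
    refine (hasDerivAt_const z (1 : ℂ)).congr_of_eventuallyEq ?_
    filter_upwards [isOpen_ne.mem_nhds hz] with y hy using mul_inv_cancel₀ hy
  -- Integration by parts with `z g₁ = 1` and `g = 0`: only the boundary term is left.
  have h1 := hγ.contourIntegral_by_parts ha (g₁ := fun z => z⁻¹) (g := fun _ => 0)
    (fun z hz => hd z (hγ.ne_zero_of_mem_range ha hz))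
    (continuousOn_id.inv₀ fun z hz => hγ.ne_zero_of_mem_range ha hz) continuousOn_const R
  have ha' : (a : ℂ) ≠ 0 := by exact_mod_cast ha.ne'
  have h0 : contourIntegral γ (fun z => 0 * R.eval (cutLog z)) = 0 := by
    simp [contourIntegral_eq]
  rw [h0, mul_inv_cancel₀ ha', one_mul, ← eval_turnDiff, eq_comm, sub_eq_zero] at h1
  rw [← h1, one_mul]
  refine hasFinitePart_of_hasDerivAt (F := fun t => (turnDiff R).eval (Real.log t : ℂ))
    (D := fun ε => ((ε : ℂ) ^ 0)⁻¹ *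
      (turnDiff R - Polynomial.C ((turnDiff R).coeff 0)).eval (Real.log ε : ℂ)) ha
    (fun t ht => ?_) ?_ (inv_pow_mul_log_mem_divergentParts 0 _ (Or.inr (by simp))) ?_
  · rw [← derivative_turnDiff, mul_comm]
    exact hasDerivAt_polynomial_log _ ht.1.ne'
  · refine ContinuousOn.mul ?_ (continuousOn_polynomial_log _ a)
    exact Complex.continuous_ofReal.continuousOn.inv₀ fun t ht => by exact_mod_cast ht.1.ne'
  · simp [Polynomial.coeff_zero_eq_eval_zero]

/-- The jump formula for a function with a pole at `0`: the Taylor coefficients of `f` are split off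
one at a time, until an analytic function remains. -/
theorem exists_hasJumpFormula_div_pow (hγ : IsStraddlingContour k a γ) (ha : 0 < a)
    {U : Set ℂ} (hUo : IsOpen U) (hUc : IsSimplyConnected U)
    (haU : (fun t : ℝ => (t : ℂ)) '' Set.Icc 0 a ⊆ U) (hγU : Set.range γ ⊆ U) (b : ℕ) :
    ∀ f : ℂ → ℂ, DifferentiableOn ℂ f U → ∃ c, HasJumpFormula γ (fun z => f z / z ^ b) c := by
  have h0U : U ∈ 𝓝 (0 : ℂ) := hUo.mem_nhds (haU ⟨0, ⟨le_rfl, ha.le⟩, by simp⟩)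
  induction b with
  | zero =>
    intro f hf
    exact ⟨0, by simpa using hasJumpFormula_of_differentiableOn hγ ha hUo hUc haU hγU hf⟩
  | succ b ih =>
    intro f hf
    have hf₁ : DifferentiableOn ℂ (dslope f 0) U := (Complex.differentiableOn_dslope h0U).2 hf
    obtain ⟨c, hc⟩ := ih _ hf₁
    obtain ⟨c', hc'⟩ : ∃ c', HasJumpFormula γ (fun z => (z ^ (b + 1))⁻¹) c' := by
      cases b with
      | zero => exact ⟨1, by simpa using hasJumpFormula_inv hγ ha⟩
      | succ m => exact ⟨0, hasJumpFormula_inv_pow hγ ha m⟩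
    have hne : ∀ z ∈ Set.range γ, ∀ m : ℕ, z ^ m ≠ 0 := fun z hz m =>
      pow_ne_zero _ (hγ.ne_zero_of_mem_range ha hz)
    refine ⟨_, ((hc'.const_mul (f 0)).add hc hγ ha (continuousOn_const.mul
      ((continuousOn_id.pow _).inv₀ fun z hz => hne z hz _))
      ((hf₁.continuousOn.mono hγU).div (continuousOn_id.pow _) fun z hz => hne z hz _)).congr hγ ha
      fun z hz => ?_⟩
    -- `f z / z ^ (b + 1) = f 0 / z ^ (b + 1) + ((f z - f 0) / z) / z ^ b`
    have h1 := sub_smul_dslope f 0 z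
    rw [sub_zero, smul_eq_mul] at h1
    rw [← sub_add_cancel (f z) (f 0), ← h1]
    field_simp
    ring

end

/-! ### Bernoulli polynomials -/

/-- The Bernoulli polynomial `B_m`, with complex coefficients. -/
noncomputable def complexBernoulli (m : ℕ) : Polynomial ℂ :=
  (Polynomial.bernoulli m).map (algebraMap ℚ ℂ)

theorem eval_complexBernoulli_add_one (m : ℕ) (x : ℂ) :
    (complexBernoulli m).eval (x + 1) = (complexBernoulli m).eval x + m * x ^ (m - 1) := by
  have h := congrArg (fun p => (p.map (algebraMap ℚ ℂ)).eval x)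
    (Polynomial.bernoulli_comp_one_add_X m)
  simp only [Polynomial.map_comp, Polynomial.eval_comp, Polynomial.map_add, Polynomial.map_one,
    Polynomial.map_X, Polynomial.eval_add, Polynomial.eval_one, Polynomial.eval_X, nsmul_eq_mul,
    Polynomial.map_mul, Polynomial.map_natCast, Polynomial.map_pow, Polynomial.eval_mul,
    Polynomial.eval_natCast, Polynomial.eval_pow] at h
  rw [add_comm x 1]
  exact h

theorem derivative_complexBernoulli_add_one (m : ℕ) :
    (complexBernoulli (m + 1)).derivative = (m + 1) * complexBernoulli m := by
  rw [complexBernoulli, Polynomial.derivative_map, Polynomial.derivative_bernoulli_add_one]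
  simp [complexBernoulli]

theorem eval_complexBernoulli (m : ℕ) (x : ℂ) : (complexBernoulli m).eval x =
    ∑ j ∈ Finset.range (m + 1), (((bernoulli (m - j) : ℚ) : ℂ) * m.choose j) * x ^ j := by
  rw [complexBernoulli, Polynomial.bernoulli_def, Polynomial.map_sum, Polynomial.eval_finsetSum]
  simp

/-- A primitive of the solution `q = w^n / (n + 1) * B_{n+1}(X / w)` of the difference equation
`q(X + w) - q(X) = X^n`, where `w = 2πi`. -/
noncomputable def turnPrimitive (n : ℕ) : Polynomial ℂ :=
  Polynomial.C ((2 * Real.pi * Complex.I) ^ (n + 1) / ((n + 1) * (n + 2))) *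
    (complexBernoulli (n + 2)).comp (Polynomial.C (2 * Real.pi * Complex.I)⁻¹ * Polynomial.X)

theorem eval_derivative_turnPrimitive (n : ℕ) (x : ℂ) :
    (turnPrimitive n).derivative.eval x = (2 * Real.pi * Complex.I) ^ n / (n + 1) *
      (complexBernoulli (n + 1)).eval ((2 * Real.pi * Complex.I)⁻¹ * x) := by
  have h1 : (n + 1 : ℂ) ≠ 0 := Nat.cast_add_one_ne_zero n
  have h2 : (n + 2 : ℂ) ≠ 0 := by exact_mod_cast (Nat.succ_ne_zero (n + 1))
  rw [turnPrimitive, Polynomial.derivative_C_mul, Polynomial.derivative_comp,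
    derivative_complexBernoulli_add_one]
  simp only [Polynomial.eval_mul, Polynomial.eval_C, Polynomial.eval_comp, Polynomial.eval_add,
    Polynomial.eval_natCast, Polynomial.eval_one, Polynomial.eval_X, Polynomial.derivative_C_mul,
    Polynomial.derivative_X]
  have hw := Complex.two_pi_I_ne_zero
  generalize (2 * Real.pi * Complex.I : ℂ) = w at hw ⊢
  push_cast
  field_simp
  ring

theorem turnDiff_derivative_turnPrimitive (n : ℕ) :
    turnDiff (turnPrimitive n).derivative = Polynomial.X ^ n := by
  refine Polynomial.funext fun x => ?_
  have h1 : (n + 1 : ℂ) ≠ 0 := Nat.cast_add_one_ne_zero n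
  rw [eval_turnDiff, eval_derivative_turnPrimitive, eval_derivative_turnPrimitive, mul_add,
    inv_mul_cancel₀ Complex.two_pi_I_ne_zero, eval_complexBernoulli_add_one, Polynomial.eval_pow,
    Polynomial.eval_X, Nat.add_sub_cancel, mul_pow _ x, inv_pow]
  have hw := Complex.two_pi_I_ne_zero
  generalize (2 * Real.pi * Complex.I : ℂ) = w at hw ⊢
  push_cast
  field_simp
  ring

/-- The residue term of the jump formula vanishes because `B_{n+2}(1) = B_{n+2}(0)`. -/
theorem eval_zero_turnDiff_turnPrimitive (n : ℕ) : (turnDiff (turnPrimitive n)).eval 0 = 0 := by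
  have h := eval_complexBernoulli_add_one (n + 2) 0
  simp only [zero_add, Nat.add_succ_sub_one, ne_eq, Nat.add_eq_zero_iff, one_ne_zero, and_false,
    not_false_eq_true, zero_pow, mul_zero, add_zero] at h
  have hw : (2 * Real.pi * Complex.I : ℂ)⁻¹ * (2 * Real.pi * Complex.I) = 1 :=
    inv_mul_cancel₀ Complex.two_pi_I_ne_zero
  simp only [eval_turnDiff, turnPrimitive, Polynomial.eval_mul, Polynomial.eval_C,
    Polynomial.eval_comp, Polynomial.eval_X, zero_add, mul_zero, hw, h, sub_self]

theorem eval_derivative_turnPrimitive_eq_sum (n : ℕ) (x : ℂ) :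
    (turnPrimitive n).derivative.eval x = ∑ j ∈ Finset.range (n + 2),
      ((2 * Real.pi * Complex.I) ^ n / (n + 1) * ((2 * Real.pi * Complex.I)⁻¹ ^ j *
        (((bernoulli (n + 1 - j) : ℚ) : ℂ) * (n + 1).choose j))) * x ^ j := by
  rw [eval_derivative_turnPrimitive, eval_complexBernoulli, Finset.mul_sum]
  refine Finset.sum_congr rfl fun j _ => ?_
  rw [mul_pow]
  ring

/-- The coefficients of `w^n / (n + 1) * B_{n+1}(X / w)` below the leading one. -/
theorem coeff_derivative_turnPrimitive {n j : ℕ} (hj : j ≤ n) :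
    (2 * Real.pi * Complex.I : ℂ) ^ n / (n + 1) * ((2 * Real.pi * Complex.I)⁻¹ ^ j *
        (((bernoulli (n + 1 - j) : ℚ) : ℂ) * (n + 1).choose j)) =
      (n.choose j : ℂ) * (2 * Real.pi * Complex.I) ^ (n - j) *
        (((bernoulli (n - j + 1) : ℚ) : ℂ) / ((n - j + 1 : ℕ) : ℂ)) := by
  obtain ⟨m, rfl⟩ := Nat.exists_eq_add_of_le hj
  have h1 : ((j + m : ℕ) + 1 : ℂ) ≠ 0 := Nat.cast_add_one_ne_zero _
  have h2 : ((m : ℕ) + 1 : ℂ) ≠ 0 := Nat.cast_add_one_ne_zero _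
  have h3 : ((j + m).choose j : ℂ) * ((j + m : ℕ) + 1) = (j + m + 1).choose j * (m + 1) := by
    have := Nat.choose_mul_succ_eq (j + m) j
    rw [show j + m + 1 - j = m + 1 by omega] at this
    exact_mod_cast this
  rw [show j + m + 1 - j = m + 1 by omega, Nat.add_sub_cancel_left, inv_pow,
    pow_add]
  have hw := Complex.two_pi_I_ne_zero
  generalize (2 * Real.pi * Complex.I : ℂ) = w at hw ⊢
  push_cast at h1 h3 ⊢
  field_simp
  linear_combination (-((bernoulli (m + 1) : ℚ) : ℂ)) * h3

/-! ### The finite part as a combination of contour integrals -/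

theorem mainTheorem4 (a : ℝ) (ha : 0 < a) (k : ℂ → ℂ)
    (hk : AnalyticOnNhd ℂ k ((fun t : ℝ => (t : ℂ)) '' Set.Icc 0 a))
    (n b : ℕ) (hn : 0 < n) (hb : 0 < b) :
    (∃ L : ℂ, HasFinitePart
      (fun t : ℝ => k (t : ℂ) * (Real.log t : ℂ) ^ n / (t : ℂ) ^ b) a L) ∧
    ∀ γ : Path (a : ℂ) (a : ℂ), IsStraddlingContour k a γ →
      finitePart (fun t : ℝ => k (t : ℂ) * (Real.log t : ℂ) ^ n / (t : ℂ) ^ b) a =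
        1 / (2 * Real.pi * Complex.I * (n + 1)) *
            contourIntegral γ (fun z => k z / z ^ b * cutLog z ^ (n + 1)) +
          ∑ j ∈ Finset.range (n + 1),
            (n.choose j : ℂ) * (2 * Real.pi * Complex.I) ^ (n - j) *
              (((bernoulli (n - j + 1) : ℚ) : ℂ) / ((n - j + 1 : ℕ) : ℂ)) *
              contourIntegral γ (fun z => k z / z ^ b * cutLog z ^ j) := by
  have key : ∀ γ : Path (a : ℂ) (a : ℂ), IsStraddlingContour k a γ →
      HasFinitePart (fun t : ℝ => k (t : ℂ) * (Real.log t : ℂ) ^ n / (t : ℂ) ^ b) a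
        (contourIntegral γ
          (fun z => k z / z ^ b * (turnPrimitive n).derivative.eval (cutLog z))) := by
    intro γ hγ
    obtain ⟨U, hUo, hUc, haU, hγU, hkU⟩ := hγ.encloses_no_singularity
    obtain ⟨c, hc⟩ := exists_hasJumpFormula_div_pow hγ ha hUo hUc haU hγU b k hkU.differentiableOn
    have h := hc (turnPrimitive n)
    rw [turnDiff_derivative_turnPrimitive, eval_zero_turnDiff_turnPrimitive, mul_zero,
      sub_zero] at h
    refine h.congr ha fun t _ => ?_
    rw [Polynomial.eval_pow, Polynomial.eval_X]
    ring
  refine ⟨?_, fun γ hγ => ?_⟩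
  · obtain ⟨γ, hγ⟩ := exists_isStraddlingContour ha hk
    exact ⟨_, key γ hγ⟩
  · obtain ⟨U, -, -, -, hγU, hkU⟩ := hγ.encloses_no_singularity
    have hcont : ContinuousOn (fun z => k z / z ^ b) (Set.range γ) :=
      (hkU.continuousOn.mono hγU).div (continuousOn_id.pow _) fun z hz =>
        pow_ne_zero _ (hγ.ne_zero_of_mem_range ha hz)
    rw [(key γ hγ).finitePart_eq]
    simp only [eval_derivative_turnPrimitive_eq_sum]
    rw [hγ.contourIntegral_sum ha hcont, Finset.sum_range_succ, add_comm]
    congr 1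
    · have hw := Complex.two_pi_I_ne_zero
      have h1 : (n + 1 : ℂ) ≠ 0 := Nat.cast_add_one_ne_zero n
      rw [Nat.sub_self, bernoulli_zero, Nat.choose_self, inv_pow, pow_succ]
      congr 1
      generalize (2 * Real.pi * Complex.I : ℂ) = w at hw ⊢
      push_cast
      field_simp
    · refine Finset.sum_congr rfl fun j hj => ?_
      rw [coeff_derivative_turnPrimitive (Nat.lt_succ_iff.1 (Finset.mem_range.1 hj))]
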